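/- Let $K$ be a field, $A=K[x_1,\dots,x_n]$ with $\mathfrak m=(x_1,\dots,x_n)$, and let $I\subset A$ be a monomial ideal. Let $\Gamma(I)=\{a\in\mathbb N^n : x^a\in I\}$, let $\operatorname{conv}(I)\subset\mathbb R^n$ be the convex hull of $\Gamma(I)$, and let $G(I)$ be the minimal set of monomial generators of $I$. A face of $\operatorname{conv}(I)$ is the empty set, $\operatorname{conv}(I)$ itself, or the intersection of $\operatorname{conv}(I)$ with a supporting hyperplane; let $\mathcal F_{mc}$ be the set of compact faces of $\operatorname{conv}(I)$ that are maximal under inclusion among the compact faces. Let $\mathcal F(I)=\mathcal R(I)/\mathfrak m\mathcal R(I)=\bigoplus_{k\ge 0} I^k/\mathfrak m I^k$ be the fiber ring of $I$, where $\mathcal R(I)=\bigoplus_{k\ge0} I^kt^k\subset A[t]$ is the Rees ring, and let $\operatorname{Min}(\mathcal F(I))$ be its set of minimal prime ideals. The ideal $I$ is called extremal if $\{a : x^a\in G(I)\}$ is the set of extreme points of $\operatorname{conv}(I)$. Then there is an injective map $\mathcal F_{mc}\to\operatorname{Min}(\mathcal F(I))$, and this map is bijective if $I$ is extremal. -/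

import Mathlib

noncomputable section

namespace MonIdeal

open MvPolynomial

variable {K : Type*} [Field K] {n : ℕ}

/-- `I` is a monomial ideal: it is generated by a set of monomials `x ^ a`. -/
def IsMonomial (I : Ideal (MvPolynomial (Fin n) K)) : Prop :=
  ∃ S : Set (Fin n →₀ ℕ), I = Ideal.span ((fun a => monomial a (1 : K)) '' S)

/-- `Γ(I)`: the exponent vectors `a` with `x ^ a ∈ I`. -/
def exponents (I : Ideal (MvPolynomial (Fin n) K)) : Set (Fin n →₀ ℕ) :=
  {a | monomial a (1 : K) ∈ I}

/-- `Γ(G(I))`: the exponent vectors of the minimal monomial generators of a monomial ideal `I`,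
i.e. of those monomials of `I` that are divisible by no other monomial of `I`. -/
def minGenExponents (I : Ideal (MvPolynomial (Fin n) K)) : Set (Fin n →₀ ℕ) :=
  {a | Minimal (· ∈ exponents I) a}

/-- An exponent vector as a point of `ℝⁿ`. -/
def toPoint (a : Fin n →₀ ℕ) : Fin n → ℝ := fun i => (a i : ℝ)

/-- `conv(I)`, the Newton polyhedron of `I`: the convex hull of `Γ(I)` in `ℝⁿ`. -/
def newtonPolyhedron (I : Ideal (MvPolynomial (Fin n) K)) : Set (Fin n → ℝ) :=
  convexHull ℝ (toPoint '' exponents I)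

/-- A monomial ideal `I` is extremal if the exponents of its minimal monomial generators are
precisely the extreme points of `conv(I)`. -/
def IsExtremal (I : Ideal (MvPolynomial (Fin n) K)) : Prop :=
  IsMonomial I ∧ toPoint '' minGenExponents I = (newtonPolyhedron I).extremePoints ℝ

/-- `F` is a compact face of `conv(I)`. A face of a convex set `X` is an exposed subset in Mathlib's
sense: the empty set, `X` itself (zero functional), or the intersection of `X` with a supporting
hyperplane. -/
def IsCompactFace (I : Ideal (MvPolynomial (Fin n) K)) (F : Set (Fin n → ℝ)) : Prop :=
  IsExposed ℝ (newtonPolyhedron I) F ∧ IsCompact F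

/-- The set of maximal (under inclusion) compact faces of `conv(I)`. -/
def maximalCompactFaces (I : Ideal (MvPolynomial (Fin n) K)) : Set (Set (Fin n → ℝ)) :=
  {F | Maximal (IsCompactFace I) F}

/-- The fiber ring `𝓕(I) = R(I) / 𝔪 R(I)`, where `R(I) ⊆ A[t]` is the Rees algebra of `I` and
`𝔪 = (x₁, …, xₙ)`. -/
abbrev FiberRing (I : Ideal (MvPolynomial (Fin n) K)) : Type _ :=
  reesAlgebra I ⧸
    (idealOfVars (Fin n) K).map (algebraMap (MvPolynomial (Fin n) K) (reesAlgebra I))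

end MonIdeal

end

namespace MonIdeal

open MvPolynomial

/-! ### Farkas' lemma and strictly positive weights -/

section Farkas

/-! Let `w` be a strictly positive weight with `w ⬝ a ≥ c` on `Γ(I)`. Every monomial of `I ^ k` has
weight at least `k c`, so keeping only the terms `x ^ a t ^ k` with `w ⬝ a = k c` is a ring
homomorphism from the Rees algebra to the domain `A[t]`. Its kernel (`facePrime`) is a prime
containing `𝔪 R(I)` that misses exactly those `x ^ a t` with `a` on the face `w ⬝ a = c`. Inclusions
of such primes therefore reverse inclusions of faces.

Conversely, let `q` be a prime containing `𝔪 R(I)`. The exponents `a` with `x ^ a t ∉ q` lie on one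
compact face (`exists_compactFace_of_isPrime`): if no suitable weight existed, Farkas' lemma would
give a product of elements outside `q` equal to `x ^ m`, `m ≠ 0`, times an element of `R(I)`, hence
in `q`. Since the `x ^ a t` generate `R(I)` over `A`, the prime of any face through all these
exponents is contained in `q` (`facePrime_le`).

There are finitely many compact faces, so each lies in a maximal one. The primes of the maximal
compact faces thus form an antichain, and every prime over `𝔪 R(I)` contains one of them: they are
exactly the minimal primes. -/

theorem sum_insert_update_smul {𝕜 M ι : Type*} [Semiring 𝕜] [AddCommMonoid M] [Module 𝕜 M]
    [DecidableEq ι] {s : Finset ι} {j : ι} (hj : j ∉ s) (c : ι → 𝕜) (a : 𝕜) (f : ι → M) :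
    ∑ i ∈ insert j s, Function.update c j a i • f i = a • f j + ∑ i ∈ s, c i • f i := by
  rw [Finset.sum_insert hj, Function.update_self]
  refine congrArg _ (Finset.sum_congr rfl fun i hi => ?_)
  rw [Function.update_of_ne (ne_of_mem_of_not_mem hi hj)]

/-- **Farkas' lemma** over a linearly ordered field, for a finite family of linear functionals. -/
theorem exists_nonneg_combination {𝕜 W : Type*} [Field 𝕜] [LinearOrder 𝕜] [IsStrictOrderedRing 𝕜]
    [AddCommGroup W] [Module 𝕜 W] {ι : Type*} [DecidableEq ι] (s : Finset ι)
    (f : ι → W →ₗ[𝕜] 𝕜) (b : W →ₗ[𝕜] 𝕜)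
    (h : ∀ x, (∀ i ∈ s, 0 ≤ f i x) → 0 ≤ b x) :
    ∃ c : ι → 𝕜, (∀ i, 0 ≤ c i) ∧ b = ∑ i ∈ s, c i • f i := by
  induction s using Finset.induction_on generalizing f b with
  | empty =>
    refine ⟨0, fun _ => le_rfl, ?_⟩
    ext x
    have h₁ := h x (by simp)
    have h₂ := h (-x) (by simp)
    rw [map_neg] at h₂
    simp only [Finset.sum_empty, LinearMap.zero_apply]
    linarith
  | insert j s hj ih =>
    by_cases hb : ∀ x, (∀ i ∈ s, 0 ≤ f i x) → 0 ≤ b x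
    · obtain ⟨c, hc, rfl⟩ := ih f b hb
      refine ⟨Function.update c j 0, fun i => ?_, ?_⟩
      · by_cases hi : i = j
        · simp [hi]
        · simp [hi, hc i]
      · rw [sum_insert_update_smul hj, zero_smul, zero_add]
    · push Not at hb
      obtain ⟨y, hy, hby⟩ := hb
      have hjy : f j y < 0 := by
        by_contra! hcon
        exact hby.not_ge (h y fun i hi => (Finset.mem_insert.1 hi).elim (fun e => e ▸ hcon) (hy i))
      have hjy' : 0 < -(f j y)⁻¹ := by simpa using hjy
      -- Normalised so that `x ↦ x + f j x • z` is a projection onto the kernel of `f j`; the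
      -- induction hypothesis is applied to the functionals composed with it.
      set z : W := (-(f j y)⁻¹) • y with hz
      have hjz : f j z = -1 := by
        rw [hz, map_smul, smul_eq_mul, neg_mul, inv_mul_cancel₀ hjy.ne]
      have hsz : ∀ i ∈ s, 0 ≤ f i z := fun i hi => by
        rw [hz, map_smul, smul_eq_mul]
        exact mul_nonneg hjy'.le (hy i hi)
      have hbz : b z < 0 := by
        rw [hz, map_smul, smul_eq_mul]
        exact mul_neg_of_pos_of_neg hjy' hby
      obtain ⟨c, hc, hbc⟩ := ih (fun i => f i + f i z • f j) (b + b z • f j) fun x hx => by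
        have := h (x + f j x • z) fun i hi => by
          rcases Finset.mem_insert.1 hi with rfl | hi
          · simp [hjz]
          · have := hx i hi
            simp only [LinearMap.add_apply, LinearMap.smul_apply, smul_eq_mul] at this
            simp only [map_add, map_smul, smul_eq_mul]
            linarith [mul_comm (f i z) (f j x)]
        simp only [map_add, map_smul, smul_eq_mul] at this
        simp only [LinearMap.add_apply, LinearMap.smul_apply, smul_eq_mul]
        linarith [mul_comm (b z) (f j x)]
      have hpos : 0 ≤ ∑ i ∈ s, c i * f i z - b z := by
        have := Finset.sum_nonneg fun i hi => mul_nonneg (hc i) (hsz i hi)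
        linarith
      refine ⟨Function.update c j (∑ i ∈ s, c i * f i z - b z), fun i => ?_, ?_⟩
      · by_cases hi : i = j
        · subst hi
          simpa using hpos
        · simp [hi, hc i]
      · rw [sum_insert_update_smul hj, sub_smul, Finset.sum_smul]
        refine (eq_sub_of_add_eq hbc).trans ?_
        simp only [smul_add, Finset.sum_add_distrib, smul_smul]
        abel

theorem exists_nat_multiple {ι : Type*} [Fintype ι] (c : ι → ℚ) (hc : ∀ i, 0 ≤ c i) :
    ∃ D : ℕ, 0 < D ∧ ∃ N : ι → ℕ, ∀ i, (N i : ℚ) = D * c i := by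
  classical
  refine ⟨∏ i, (c i).den, Finset.prod_pos fun i _ => (c i).den_pos,
    fun i => (∏ j ∈ Finset.univ.erase i, (c j).den) * (c i).num.toNat, fun i => ?_⟩
  rw [← Finset.prod_erase_mul _ _ (Finset.mem_univ i)]
  have h₁ : (((c i).num.toNat : ℕ) : ℚ) = ((c i).num : ℚ) := by
    exact_mod_cast congrArg (Int.cast : ℤ → ℚ) (Int.toNat_of_nonneg (Rat.num_nonneg.2 (hc i)))
  rw [Nat.cast_mul, h₁, Nat.cast_mul, mul_assoc, Rat.den_mul_eq_num]

variable {n : ℕ} {ι : Type*} [Fintype ι]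

/-- Working over `ℚ` lets the Farkas coefficients be cleared to natural numbers. Positivity is
obtained one coordinate at a time; summing the resulting weights makes all coordinates positive. -/
theorem exists_rat_weight (g s : ι → Fin n →₀ ℕ)
    (h : ∀ (N : ι → ℕ) (m : Fin n →₀ ℕ), ∑ i, N i • s i = ∑ i, N i • g i + m → m = 0)
    (i₀ : Fin n) :
    ∃ w : Fin n → ℚ, (∀ i, 0 ≤ w i) ∧ 0 < w i₀ ∧
      ∀ j, ∑ i, w i * (s j i : ℚ) ≤ ∑ i, w i * (g j i : ℚ) := by
  classical
  by_contra! hcon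
  let f : ι ⊕ Fin n → (Fin n → ℚ) →ₗ[ℚ] ℚ := Sum.elim
    (fun j => ∑ i, ((g j i : ℚ) - s j i) • LinearMap.proj i) (fun i => LinearMap.proj i)
  obtain ⟨c, hc, hb⟩ := exists_nonneg_combination Finset.univ f (-LinearMap.proj i₀) fun w hw => by
    by_contra! hneg
    obtain ⟨j, hj⟩ := hcon w (fun i => by simpa [f] using hw (Sum.inr i) (Finset.mem_univ _))
      (by simpa using hneg)
    have := hw (Sum.inl j) (Finset.mem_univ _)
    simp only [f, Sum.elim_inl, LinearMap.sum_apply, LinearMap.smul_apply, LinearMap.proj_apply,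
      smul_eq_mul, sub_mul, Finset.sum_sub_distrib] at this
    simp only [mul_comm (w _)] at hj
    linarith
  obtain ⟨D, hD, N, hN⟩ := exists_nat_multiple c hc
  -- Clearing denominators in `-e_{i₀} = ∑ c_j (g_j - s_j) + ∑ c_i e_i` gives a forbidden relation:
  -- the remainder `m` has `i₀`-th entry at least `D > 0`.
  have key := h (fun j => N (Sum.inl j))
    (Finsupp.equivFunOnFinite.symm (fun i => N (Sum.inr i) + if i = i₀ then D else 0)) (by
      ext k
      have hk := congrArg (fun φ => (D : ℚ) * φ (Pi.single k 1)) hb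
      simp only [Fintype.sum_sum_type, f, Sum.elim_inl, Sum.elim_inr, LinearMap.add_apply,
        LinearMap.sum_apply, LinearMap.smul_apply, LinearMap.proj_apply, LinearMap.neg_apply,
        smul_eq_mul, Pi.single_apply, mul_ite, mul_one, mul_zero, Finset.sum_ite_eq',
        Finset.mem_univ, if_true, mul_add, Finset.mul_sum, ← mul_assoc, ← hN, mul_sub,
        Finset.sum_sub_distrib] at hk
      simp only [Finsupp.coe_add, Pi.add_apply, Finsupp.finsetSum_apply, Finsupp.smul_apply,
        smul_eq_mul, Finsupp.equivFunOnFinite_symm_apply_apply]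
      rw [← Nat.cast_inj (R := ℚ)]
      push_cast
      by_cases hki : k = i₀
      · subst hki
        simp at hk ⊢
        linarith
      · simp [hki, Ne.symm hki] at hk ⊢
        linarith)
  have := DFunLike.congr_fun key i₀
  simp at this
  omega

/-- A strictly positive weight satisfying finitely many inequalities between exponent vectors
exists, unless a positive combination of these exponent vectors obstructs it. -/
theorem exists_weight (g s : ι → Fin n →₀ ℕ)
    (h : ∀ (N : ι → ℕ) (m : Fin n →₀ ℕ), ∑ i, N i • s i = ∑ i, N i • g i + m → m = 0) :
    ∃ w : Fin n → ℝ, (∀ i, 0 < w i) ∧ ∀ j, w ⬝ᵥ toPoint (s j) ≤ w ⬝ᵥ toPoint (g j) := by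
  choose w hw₀ hw₁ hw₂ using exists_rat_weight g s h
  refine ⟨fun i => ((∑ k, w k i : ℚ) : ℝ), fun i => ?_, fun j => ?_⟩
  · have : 0 < ∑ k, w k i := Finset.sum_pos' (fun k _ => hw₀ k i) ⟨i, Finset.mem_univ _, hw₁ i⟩
    exact Rat.cast_pos.2 this
  · simp only [dotProduct, toPoint]
    have : ∑ i, (∑ k, w k i) * (s j i : ℚ) ≤ ∑ i, (∑ k, w k i) * (g j i : ℚ) := by
      simp only [Finset.sum_mul]
      rw [Finset.sum_comm, Finset.sum_comm (f := fun i k => w k i * (g j i : ℚ))]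
      exact Finset.sum_le_sum fun k _ => hw₂ k j
    exact_mod_cast this

end Farkas

/-! ### Initial forms on the Rees algebra and the primes of faces -/

section InitialForm

variable {K : Type*} [Field K] {n : ℕ}

theorem weight_eq_dotProduct (w : Fin n → ℝ) (a : Fin n →₀ ℕ) :
    Finsupp.weight w a = w ⬝ᵥ toPoint a := by
  rw [Finsupp.weight_apply, Finsupp.sum_fintype _ _ fun i => zero_smul ℕ (w i)]
  simp [dotProduct, toPoint, mul_comm]

theorem toPoint_add (a b : Fin n →₀ ℕ) : toPoint (a + b) = toPoint a + toPoint b := by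
  ext i
  simp [toPoint]

theorem dotProduct_toPoint_nonneg {w : Fin n → ℝ} (hw : ∀ i, 0 < w i) (a : Fin n →₀ ℕ) :
    0 ≤ w ⬝ᵥ toPoint a :=
  Finset.sum_nonneg fun i _ => mul_nonneg (hw i).le (Nat.cast_nonneg _)

theorem dotProduct_toPoint_pos {w : Fin n → ℝ} (hw : ∀ i, 0 < w i) {a : Fin n →₀ ℕ} (ha : a ≠ 0) :
    0 < w ⬝ᵥ toPoint a := by
  obtain ⟨i, hi⟩ := Finsupp.ne_iff.1 ha
  exact Finset.sum_pos' (fun i _ => mul_nonneg (hw i).le (Nat.cast_nonneg _))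
    ⟨i, Finset.mem_univ _, mul_pos (hw i) (Nat.cast_pos.2 (Nat.pos_of_ne_zero hi))⟩

theorem add_mem_exponents {I : Ideal (MvPolynomial (Fin n) K)} {a : Fin n →₀ ℕ}
    (ha : a ∈ exponents I) (b : Fin n →₀ ℕ) : b + a ∈ exponents I := by
  have : monomial (b + a) (1 : K) = monomial b 1 * monomial a 1 := by simp [monomial_mul]
  change monomial (b + a) (1 : K) ∈ I
  rw [this]
  exact I.mul_mem_left _ ha

theorem IsMonomial.eq_span_exponents {I : Ideal (MvPolynomial (Fin n) K)} (hI : IsMonomial I) :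
    I = Ideal.span ((fun a => monomial a (1 : K)) '' exponents I) := by
  refine le_antisymm ?_ (Ideal.span_le.2 (by rintro _ ⟨a, ha, rfl⟩; exact ha))
  obtain ⟨S, hS⟩ := hI
  conv_lhs => rw [hS]
  refine Ideal.span_mono (Set.image_mono fun a ha => ?_)
  change monomial a (1 : K) ∈ I
  rw [hS]
  exact Ideal.subset_span ⟨a, ha, rfl⟩

/-- The ideal of the polynomials all of whose monomials have `w`-weight at least `u`. -/
def weightIdeal (K : Type*) [Field K] {w : Fin n → ℝ} (hw : ∀ i, 0 < w i) (u : ℝ) :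
    Ideal (MvPolynomial (Fin n) K) where
  carrier := {p | ∀ a, coeff a p ≠ 0 → u ≤ w ⬝ᵥ toPoint a}
  add_mem' := fun {p q} hp hq a ha => by
    by_cases h : coeff a p = 0
    · exact hq a (by simpa [h] using ha)
    · exact hp a h
  zero_mem' := fun a ha => by simp at ha
  smul_mem' := fun p q hq a ha => by
    classical
    rw [smul_eq_mul, coeff_mul] at ha
    obtain ⟨⟨b, d⟩, hbd, h⟩ := Finset.exists_ne_zero_of_sum_ne_zero ha
    rw [Finset.HasAntidiagonal.mem_antidiagonal] at hbd
    rw [← hbd, toPoint_add, dotProduct_add]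
    linarith [hq d (right_ne_zero_of_mul h), dotProduct_toPoint_nonneg hw b]

theorem weightIdeal_mul_le {w : Fin n → ℝ} (hw : ∀ i, 0 < w i) (u v : ℝ) :
    weightIdeal K hw u * weightIdeal K hw v ≤ weightIdeal K hw (u + v) := by
  classical
  refine Ideal.mul_le.2 fun p hp q hq a ha => ?_
  rw [coeff_mul] at ha
  obtain ⟨⟨b, d⟩, hbd, h⟩ := Finset.exists_ne_zero_of_sum_ne_zero ha
  rw [Finset.HasAntidiagonal.mem_antidiagonal] at hbd
  rw [← hbd, toPoint_add, dotProduct_add]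
  linarith [hp b (left_ne_zero_of_mul h), hq d (right_ne_zero_of_mul h)]

/-- `w` is a strictly positive functional bounded below by `c` on the exponents of `I`. -/
structure Supports (I : Ideal (MvPolynomial (Fin n) K)) (w : Fin n → ℝ) (c : ℝ) : Prop where
  pos : ∀ i, 0 < w i
  le : ∀ a ∈ exponents I, c ≤ w ⬝ᵥ toPoint a

variable {I : Ideal (MvPolynomial (Fin n) K)} {w : Fin n → ℝ} {c : ℝ}

theorem Supports.pow_le_weightIdeal (hI : IsMonomial I) (h : Supports I w c) (k : ℕ) :
    I ^ k ≤ weightIdeal K h.pos (k * c) := by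
  induction k with
  | zero =>
    intro p _ a _
    simpa using dotProduct_toPoint_nonneg h.pos a
  | succ k ih =>
    have hI' : I ≤ weightIdeal K h.pos c := by
      refine hI.eq_span_exponents.le.trans (Ideal.span_le.2 ?_)
      rintro _ ⟨a, ha, rfl⟩ b hb
      classical
      rw [coeff_monomial] at hb
      obtain rfl : a = b := by
        by_contra hab
        exact hb (if_neg hab)
      exact h.le _ ha
    rw [pow_succ, Nat.cast_succ, add_mul, one_mul]
    exact (Ideal.mul_mono ih hI').trans (weightIdeal_mul_le _ _ _)

/-- The part of a polynomial in `A[t]` consisting of the terms `x ^ a t ^ k` with `w ⬝ a = k c`. -/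
noncomputable def initialForm (w : Fin n → ℝ) (c : ℝ) (f : Polynomial (MvPolynomial (Fin n) K)) :
    Polynomial (MvPolynomial (Fin n) K) :=
  ∑ k ∈ f.support, Polynomial.monomial k (weightedHomogeneousComponent w (k * c) (f.coeff k))

theorem coeff_initialForm (f : Polynomial (MvPolynomial (Fin n) K)) (k : ℕ) :
    (initialForm w c f).coeff k = weightedHomogeneousComponent w (k * c) (f.coeff k) := by
  classical
  rw [initialForm, Polynomial.finsetSum_coeff]
  simp only [Polynomial.coeff_monomial, Finset.sum_ite_eq']
  split_ifs with h
  · rfl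
  · rw [Polynomial.notMem_support_iff.1 h, map_zero]

open Classical in
theorem coeff_coeff_initialForm (f : Polynomial (MvPolynomial (Fin n) K)) (k : ℕ)
    (a : Fin n →₀ ℕ) : coeff a ((initialForm w c f).coeff k) =
      if w ⬝ᵥ toPoint a = k * c then coeff a (f.coeff k) else 0 := by
  rw [coeff_initialForm, coeff_weightedHomogeneousComponent, weight_eq_dotProduct]

theorem initialForm_monomial_of_eq {a : Fin n →₀ ℕ} {k : ℕ} (h : w ⬝ᵥ toPoint a = k * c) (r : K) :
    initialForm w c (Polynomial.monomial k (monomial a r)) =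
      Polynomial.monomial k (monomial a r) := by
  classical
  ext l b
  rw [coeff_coeff_initialForm, ite_eq_left_iff, Polynomial.coeff_monomial]
  intro hb
  split_ifs with hkl
  · rw [coeff_monomial, if_neg]
    rintro rfl
    exact hb (hkl ▸ h)
  · simp

theorem initialForm_monomial_of_ne {a : Fin n →₀ ℕ} {k : ℕ} (h : w ⬝ᵥ toPoint a ≠ k * c) (r : K) :
    initialForm w c (Polynomial.monomial k (monomial a r)) = 0 := by
  classical
  ext l b
  rw [coeff_coeff_initialForm, Polynomial.coeff_zero, coeff_zero, ite_eq_right_iff,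
    Polynomial.coeff_monomial]
  intro hb
  split_ifs with hkl
  · rw [coeff_monomial, if_neg]
    rintro rfl
    exact h (hkl ▸ hb)
  · simp

/-- Membership in the Rees algebra is essential: both factors have only terms of weight at least `k
c` in degree `k`, so a product of terms attains the bound only if both factors do. -/
theorem initialForm_mul (hI : IsMonomial I) (h : Supports I w c) (f g : reesAlgebra I) :
    initialForm w c (f * g : Polynomial (MvPolynomial (Fin n) K)) =
      initialForm w c f * initialForm w c g := by
  classical
  ext k a
  rw [coeff_coeff_initialForm, Polynomial.coeff_mul, Polynomial.coeff_mul, coeff_sum, coeff_sum]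
  have key : ∀ x ∈ Finset.HasAntidiagonal.antidiagonal k, ∀ y ∈ Finset.HasAntidiagonal.antidiagonal a,
      coeff y.1 ((initialForm w c (f : Polynomial (MvPolynomial (Fin n) K))).coeff x.1) *
        coeff y.2 ((initialForm w c (g : Polynomial (MvPolynomial (Fin n) K))).coeff x.2) =
      if w ⬝ᵥ toPoint a = k * c then coeff y.1 ((f : Polynomial (MvPolynomial (Fin n) K)).coeff x.1) *
        coeff y.2 ((g : Polynomial (MvPolynomial (Fin n) K)).coeff x.2) else 0 := by
    rintro ⟨i, j⟩ hx ⟨b, d⟩ hy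
    rw [Finset.HasAntidiagonal.mem_antidiagonal] at hx hy
    simp only at hx hy ⊢
    rw [← hx, ← hy, toPoint_add, dotProduct_add, coeff_coeff_initialForm, coeff_coeff_initialForm,
      Nat.cast_add, add_mul]
    by_cases hb : coeff b ((f : Polynomial (MvPolynomial (Fin n) K)).coeff i) = 0
    · simp [hb]
    by_cases hd : coeff d ((g : Polynomial (MvPolynomial (Fin n) K)).coeff j) = 0
    · simp [hd]
    have h₁ := h.pow_le_weightIdeal hI i (f.2 i) b hb
    have h₂ := h.pow_le_weightIdeal hI j (g.2 j) d hd
    by_cases e₁ : w ⬝ᵥ toPoint b = i * c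
    · simp [e₁]
    · have : w ⬝ᵥ toPoint b + w ⬝ᵥ toPoint d ≠ i * c + j * c := fun e => e₁ (by linarith)
      rw [if_neg e₁, if_neg this, zero_mul]
  simp only [coeff_mul]
  rw [Finset.sum_congr rfl fun x hx => Finset.sum_congr rfl (key x hx)]
  split_ifs <;> simp

/-- Taking initial forms is a ring homomorphism on the Rees algebra. -/
noncomputable def initialFormHom (hI : IsMonomial I) (h : Supports I w c) :
    reesAlgebra I →+* Polynomial (MvPolynomial (Fin n) K) where
  toFun f := initialForm w c f
  map_one' := by
    have := initialForm_monomial_of_eq (K := K) (w := w) (c := c) (a := 0) (k := 0)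
      (by simp [toPoint, dotProduct]) 1
    simpa using this
  map_mul' f g := initialForm_mul hI h f g
  map_zero' := by
    simp [initialForm]
  map_add' f g := by
    ext k
    simp [coeff_initialForm]

/-- The kernel of the initial form map: the prime ideal of the Rees algebra attached to the face
of the Newton polyhedron on which `w` takes the value `c`. -/
noncomputable def facePrime (hI : IsMonomial I) (h : Supports I w c) : Ideal (reesAlgebra I) :=
  RingHom.ker (initialFormHom hI h)

instance (hI : IsMonomial I) (h : Supports I w c) : (facePrime hI h).IsPrime :=
  RingHom.ker_isPrime _

theorem mem_facePrime {hI : IsMonomial I} {h : Supports I w c} {f : reesAlgebra I} :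
    f ∈ facePrime hI h ↔ initialForm w c (f : Polynomial (MvPolynomial (Fin n) K)) = 0 :=
  Iff.rfl

/-- The extension of `𝔪` to the Rees algebra. -/
noncomputable abbrev fiberIdeal (I : Ideal (MvPolynomial (Fin n) K)) : Ideal (reesAlgebra I) :=
  (idealOfVars (Fin n) K).map (algebraMap (MvPolynomial (Fin n) K) (reesAlgebra I))

theorem coe_algebraMap_monomial (a : Fin n →₀ ℕ) (r : K) :
    ((algebraMap (MvPolynomial (Fin n) K) (reesAlgebra I) (monomial a r) : reesAlgebra I) :
      Polynomial (MvPolynomial (Fin n) K)) = Polynomial.monomial 0 (monomial a r) := rfl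

theorem algebraMap_monomial_mem_fiberIdeal {a : Fin n →₀ ℕ} (ha : a ≠ 0) (r : K) :
    algebraMap (MvPolynomial (Fin n) K) (reesAlgebra I) (monomial a r) ∈ fiberIdeal I := by
  classical
  refine Ideal.mem_map_of_mem _ ?_
  have := (mem_pow_idealOfVars_iff' 1 (monomial a r)).2 fun x hx => by
    rw [coeff_monomial, if_neg]
    rintro rfl
    exact ha ((Finsupp.degree_eq_zero_iff _).1 (by omega))
  simpa using this

theorem fiberIdeal_le_facePrime (hI : IsMonomial I) (h : Supports I w c) :
    fiberIdeal I ≤ facePrime hI h := by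
  rw [fiberIdeal, Ideal.map_le_iff_le_comap, idealOfVars, Ideal.span_le]
  rintro _ ⟨i, rfl⟩
  change initialForm w c (Polynomial.monomial 0 (monomial (Finsupp.single i 1) 1)) = 0
  refine initialForm_monomial_of_ne ?_ _
  have := dotProduct_toPoint_pos h.pos (a := Finsupp.single i 1) (by simp)
  simpa using this.ne'

/-- The element `x ^ a t` of the Rees algebra. -/
noncomputable def monomialT (I : Ideal (MvPolynomial (Fin n) K)) (a : exponents I) :
    reesAlgebra I :=
  ⟨Polynomial.monomial 1 (monomial (a : Fin n →₀ ℕ) 1),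
    reesAlgebra.monomial_mem.2 (by rw [pow_one]; exact a.2)⟩

theorem monomialT_mem_facePrime {hI : IsMonomial I} {h : Supports I w c} {a : exponents I} :
    monomialT I a ∈ facePrime hI h ↔ w ⬝ᵥ toPoint (a : Fin n →₀ ℕ) ≠ c := by
  rw [mem_facePrime]
  refine ⟨fun ha hc => ?_, fun ha => initialForm_monomial_of_ne (by simpa using ha) _⟩
  rw [monomialT, initialForm_monomial_of_eq (by simpa using hc)] at ha
  simp at ha

/-- The subring of the elements congruent modulo `J` to their own initial form. -/
def initialSubring (hI : IsMonomial I) (h : Supports I w c) (J : Ideal (reesAlgebra I)) :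
    Subring (reesAlgebra I) where
  carrier := {f | ∃ g : reesAlgebra I, initialFormHom hI h g = g ∧ f - g ∈ J}
  mul_mem' := by
    rintro f f' ⟨g, hg, hf⟩ ⟨g', hg', hf'⟩
    refine ⟨g * g', by rw [map_mul, hg, hg']; rfl, ?_⟩
    have : f * f' - g * g' = (f - g) * f' + g * (f' - g') := by ring
    rw [this]
    exact add_mem (J.mul_mem_right _ hf) (J.mul_mem_left _ hf')
  one_mem' := ⟨1, by rw [map_one]; rfl, by simp⟩
  add_mem' := by
    rintro f f' ⟨g, hg, hf⟩ ⟨g', hg', hf'⟩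
    refine ⟨g + g', by rw [map_add, hg, hg']; rfl, ?_⟩
    rw [add_sub_add_comm]
    exact add_mem hf hf'
  zero_mem' := ⟨0, by rw [map_zero]; rfl, by simp⟩
  neg_mem' := by
    rintro f ⟨g, hg, hf⟩
    refine ⟨-g, by rw [map_neg, hg]; rfl, ?_⟩
    rw [← neg_sub']
    exact neg_mem hf

theorem mem_initialSubring_of_mem {hI : IsMonomial I} {h : Supports I w c}
    {J : Ideal (reesAlgebra I)} {f : reesAlgebra I} (hf : f ∈ J) : f ∈ initialSubring hI h J :=
  ⟨0, by rw [map_zero]; rfl, by rwa [sub_zero]⟩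

theorem mem_initialSubring_of_eq {hI : IsMonomial I} {h : Supports I w c}
    {J : Ideal (reesAlgebra I)} {f : reesAlgebra I}
    (hf : initialForm w c (f : Polynomial (MvPolynomial (Fin n) K)) = f) :
    f ∈ initialSubring hI h J :=
  ⟨f, hf, by simp⟩

/-- Modulo `q ⊓ facePrime`, each generator of the Rees algebra is either zero or equal to its own
initial form, so every `f` is congruent to some `g` fixed by taking initial forms. If `f` lies in
`facePrime`, so does `g`, whence `g = 0` and `f ∈ q`. -/
theorem facePrime_le (hI : IsMonomial I) (h : Supports I w c) {q : Ideal (reesAlgebra I)}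
    (hq : fiberIdeal I ≤ q)
    (hS : ∀ a : exponents I, monomialT I a ∉ q → w ⬝ᵥ toPoint (a : Fin n →₀ ℕ) = c) :
    facePrime hI h ≤ q := by
  set D := initialSubring hI h (q ⊓ facePrime hI h) with hD
  have hmon : ∀ a r, algebraMap (MvPolynomial (Fin n) K) (reesAlgebra I) (monomial a r) ∈ D := by
    intro a r
    by_cases ha : a = 0
    · subst ha
      exact mem_initialSubring_of_eq
        (initialForm_monomial_of_eq (by simp [toPoint, dotProduct]) r)
    · have := algebraMap_monomial_mem_fiberIdeal (I := I) ha r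
      exact mem_initialSubring_of_mem
        (Submodule.mem_inf.2 ⟨hq this, fiberIdeal_le_facePrime hI h this⟩)
  have hbase : ∀ p, algebraMap (MvPolynomial (Fin n) K) (reesAlgebra I) p ∈ D := by
    intro p
    rw [p.as_sum, map_sum]
    exact sum_mem fun a _ => hmon _ _
  have hT : ∀ a, monomialT I a ∈ D := by
    intro a
    by_cases ha : w ⬝ᵥ toPoint (a : Fin n →₀ ℕ) = c
    · exact mem_initialSubring_of_eq (initialForm_monomial_of_eq (by simpa using ha) 1)
    · exact mem_initialSubring_of_mem (Submodule.mem_inf.2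
        ⟨not_not.1 fun hna => ha (hS a hna), monomialT_mem_facePrime.2 ha⟩)
  have hI1 : ∀ p (hp : p ∈ I), ∃ f ∈ D, (f : Polynomial (MvPolynomial (Fin n) K)) =
      Polynomial.monomial 1 p := by
    intro p hp
    rw [hI.eq_span_exponents] at hp
    induction hp using Submodule.span_induction with
    | mem x hx =>
      obtain ⟨a, ha, rfl⟩ := hx
      exact ⟨_, hT ⟨a, ha⟩, rfl⟩
    | zero => exact ⟨0, zero_mem _, by simp⟩
    | add x y _ _ hx hy =>
      obtain ⟨f, hf, hf'⟩ := hx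
      obtain ⟨g, hg, hg'⟩ := hy
      exact ⟨f + g, add_mem hf hg, by simp [hf', hg']⟩
    | smul r x _ hx =>
      obtain ⟨f, hf, hf'⟩ := hx
      exact ⟨_, mul_mem (hbase r) hf, by
        rw [MulMemClass.coe_mul, hf']
        exact Polynomial.C_mul_monomial⟩
  have hall : ∀ f ∈ reesAlgebra I, ∃ g ∈ D, (g : Polynomial (MvPolynomial (Fin n) K)) = f := by
    intro f hf
    rw [← adjoin_monomial_eq_reesAlgebra] at hf
    induction hf using Algebra.adjoin_induction with
    | mem x hx =>
      obtain ⟨p, hp, rfl⟩ := hx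
      exact hI1 p hp
    | algebraMap r => exact ⟨_, hbase r, rfl⟩
    | add x y _ _ hx hy =>
      obtain ⟨f, hf, hf'⟩ := hx
      obtain ⟨g, hg, hg'⟩ := hy
      exact ⟨f + g, add_mem hf hg, by simp [hf', hg']⟩
    | mul x y _ _ hx hy =>
      obtain ⟨f, hf, hf'⟩ := hx
      obtain ⟨g, hg, hg'⟩ := hy
      exact ⟨f * g, mul_mem hf hg, by simp [hf', hg']⟩
  intro f hf
  obtain ⟨f', hf', hff'⟩ := hall f f.2
  obtain rfl : f' = f := Subtype.ext hff'
  obtain ⟨g, hg, hfg⟩ := hf'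
  have hg0 : g ∈ facePrime hI h := by
    simpa using sub_mem hf hfg.2
  have : g = 0 := Subtype.ext (hg.symm.trans hg0)
  rw [this, sub_zero] at hfg
  exact hfg.1

end InitialForm

/-! ### Compact faces as supports of strictly positive weights -/

section Faces

variable {K : Type*} [Field K] {n : ℕ} {I : Ideal (MvPolynomial (Fin n) K)} {w : Fin n → ℝ} {c : ℝ}

/-- The face of the Newton polyhedron on which `w` takes the value `c`. -/
def supportFace (I : Ideal (MvPolynomial (Fin n) K)) (w : Fin n → ℝ) (c : ℝ) : Set (Fin n → ℝ) :=
  {x ∈ newtonPolyhedron I | w ⬝ᵥ x = c}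

theorem toPoint_mem_newtonPolyhedron {a : Fin n →₀ ℕ} (ha : a ∈ exponents I) :
    toPoint a ∈ newtonPolyhedron I :=
  subset_convexHull ℝ _ ⟨a, ha, rfl⟩

theorem Supports.supportFace_eq_and_le (h : Supports I w c) :
    (∀ x ∈ newtonPolyhedron I, c ≤ w ⬝ᵥ x) ∧
    supportFace I w c = convexHull ℝ (toPoint '' {a ∈ exponents I | w ⬝ᵥ toPoint a = c}) := by
  set T := convexHull ℝ (toPoint '' {a ∈ exponents I | w ⬝ᵥ toPoint a = c}) with hT
  have hTc : ∀ x ∈ T, w ⬝ᵥ x = c := by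
    have : Convex ℝ {x : Fin n → ℝ | w ⬝ᵥ x = c} := by
      intro x hx y hy s t _ _ hst
      simp only [Set.mem_ofPred_eq] at hx hy ⊢
      rw [dotProduct_add, dotProduct_smul, dotProduct_smul, hx, hy, ← add_smul, hst, one_smul]
    exact fun x hx => convexHull_min (by rintro _ ⟨a, ha, rfl⟩; exact ha.2) this hx
  -- The union of `T` with the open half-space is convex and contains all exponents, so it contains
  -- `conv(I)`; both claims follow.
  have hconv : Convex ℝ {x : Fin n → ℝ | x ∈ T ∨ c < w ⬝ᵥ x} := by
    have hle : ∀ x, x ∈ T ∨ c < w ⬝ᵥ x → c ≤ w ⬝ᵥ x :=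
      fun x hx => hx.elim (fun hx => (hTc x hx).ge) le_of_lt
    rw [convex_iff_forall_pos]
    intro x hx y hy s t hs ht hst
    have key : ∀ u v : ℝ, c ≤ u → c ≤ v → (c < u ∨ c < v) → c < s * u + t * v := by
      intro u v hu hv huv
      have e : c = s * c + t * c := by rw [← add_mul, hst, one_mul]
      rcases huv with huv | huv
      · nlinarith [mul_lt_mul_of_pos_left huv hs, mul_le_mul_of_nonneg_left hv ht.le]
      · nlinarith [mul_lt_mul_of_pos_left huv ht, mul_le_mul_of_nonneg_left hu hs.le]
    have key' := key _ _ (hle x hx) (hle y hy)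
    simp only [Set.mem_ofPred_eq] at hx hy ⊢
    rw [dotProduct_add, dotProduct_smul, dotProduct_smul, smul_eq_mul, smul_eq_mul]
    rcases hx with hx | hx
    · rcases hy with hy | hy
      · exact Or.inl (convex_convexHull ℝ _ hx hy hs.le ht.le hst)
      · exact Or.inr (key' (Or.inr hy))
    · exact Or.inr (key' (Or.inl hx))
  have hsub : newtonPolyhedron I ⊆ {x : Fin n → ℝ | x ∈ T ∨ c < w ⬝ᵥ x} := by
    refine convexHull_min ?_ hconv
    rintro _ ⟨a, ha, rfl⟩
    rcases (h.le a ha).eq_or_lt with e | e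
    · exact Or.inl (subset_convexHull ℝ _ ⟨a, ⟨ha, e.symm⟩, rfl⟩)
    · exact Or.inr e
  refine ⟨fun x hx => (hsub hx).elim (fun hx => (hTc x hx).ge) le_of_lt, ?_⟩
  refine Set.Subset.antisymm (fun x hx => (hsub hx.1).resolve_right hx.2.not_gt) fun x hx => ?_
  exact ⟨convexHull_mono (Set.image_mono fun a ha => ha.1) hx, hTc x hx⟩

theorem Supports.mem_minGenExponents (h : Supports I w c) {a : Fin n →₀ ℕ} (ha : a ∈ exponents I)
    (hac : w ⬝ᵥ toPoint a = c) : a ∈ minGenExponents I := by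
  refine ⟨ha, fun b hb hba => ?_⟩
  obtain ⟨d, rfl⟩ := exists_add_of_le hba
  have h₁ := h.le b hb
  rw [toPoint_add, dotProduct_add] at hac
  have hd : d = 0 := by
    by_contra hd
    linarith [dotProduct_toPoint_pos h.pos hd]
  simp [hd]

/-- Dickson's lemma: `ℕⁿ` is well-quasi-ordered, so its antichains are finite. -/
theorem finite_minGenExponents (I : Ideal (MvPolynomial (Fin n) K)) :
    (minGenExponents I).Finite :=
  WellQuasiOrderedLE.finite_of_isAntichain (setOfPred_minimal_antichain _)

theorem Supports.isCompactFace (h : Supports I w c) {a : Fin n →₀ ℕ} (ha : a ∈ exponents I)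
    (hac : w ⬝ᵥ toPoint a = c) : IsCompactFace I (supportFace I w c) := by
  refine ⟨fun _ => ⟨-∑ i, w i • ContinuousLinearMap.proj i, ?_⟩, ?_⟩
  · have hl : ∀ x : Fin n → ℝ,
        (-∑ i, w i • ContinuousLinearMap.proj i : StrongDual ℝ (Fin n → ℝ)) x = -(w ⬝ᵥ x) := by
      intro x
      simp [dotProduct]
    ext x
    simp only [supportFace, Set.mem_ofPred_eq, hl, neg_le_neg_iff]
    refine and_congr_right fun hx => ⟨fun hxc y hy => ?_, fun hy => ?_⟩
    · rw [hxc]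
      exact h.supportFace_eq_and_le.1 y hy
    · exact le_antisymm (hac ▸ hy _ (toPoint_mem_newtonPolyhedron ha))
        (h.supportFace_eq_and_le.1 x hx)
  · have hfin : {a ∈ exponents I | w ⬝ᵥ toPoint a = c}.Finite :=
      (finite_minGenExponents I).subset fun a ha => h.mem_minGenExponents ha.1 ha.2
    rw [h.supportFace_eq_and_le.2]
    exact (hfin.image _).isCompact_convexHull (𝕜 := ℝ)

theorem add_toPoint_mem_newtonPolyhedron {x : Fin n → ℝ} (hx : x ∈ newtonPolyhedron I)
    (b : Fin n →₀ ℕ) : x + toPoint b ∈ newtonPolyhedron I := by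
  have : Convex ℝ {x : Fin n → ℝ | x + toPoint b ∈ newtonPolyhedron I} :=
    (convex_convexHull ℝ _).translate_preimage_left _
  refine convexHull_min ?_ this hx
  rintro _ ⟨a, ha, rfl⟩
  change toPoint a + toPoint b ∈ newtonPolyhedron I
  rw [← toPoint_add, add_comm]
  exact toPoint_mem_newtonPolyhedron (add_mem_exponents ha b)

/-- Since `conv(I) + ℕⁿ ⊆ conv(I)`, a supporting functional is nonnegative on each basis vector; if
it vanished on one, the face would contain arbitrarily distant points in that direction. The sign
change from `l` to `w` is due to exposed faces being sets of maximisers. -/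
theorem IsCompactFace.exists_supports {F : Set (Fin n → ℝ)} (hF : IsCompactFace I F)
    (hne : F.Nonempty) : ∃ w c, Supports I w c ∧ F = supportFace I w c := by
  obtain ⟨l, hl⟩ := hF.1 hne
  obtain ⟨x, hx⟩ := hne
  have hx' := hx
  rw [hl] at hx'
  have hdot : ∀ y : Fin n → ℝ, (fun i => -l (Pi.single i 1)) ⬝ᵥ y = -l y := by
    intro y
    have := LinearMap.pi_apply_eq_sum_univ (l : (Fin n → ℝ) →ₗ[ℝ] ℝ) y
    simp only [ContinuousLinearMap.coe_coe, smul_eq_mul] at this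
    rw [this, dotProduct, ← Finset.sum_neg_distrib]
    refine Finset.sum_congr rfl fun i _ => ?_
    rw [neg_mul, mul_comm]
    congr 3
    ext j
    simp [Pi.single_apply, eq_comm]
  have hpoint : ∀ (i : Fin n) (N : ℕ),
      toPoint (Finsupp.single i N) = (N : ℝ) • (Pi.single i 1 : Fin n → ℝ) := by
    intro i N
    ext j
    simp [toPoint, Finsupp.single_apply, Pi.single_apply, eq_comm]
  refine ⟨fun i => -l (Pi.single i 1), -l x, ⟨fun i => ?_, fun a ha => ?_⟩, ?_⟩
  · have hle : l (Pi.single i 1) ≤ 0 := by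
      have := hx'.2 _ (add_toPoint_mem_newtonPolyhedron hx'.1 (Finsupp.single i 1))
      rw [hpoint, map_add, map_smul] at this
      simpa using this
    rcases hle.lt_or_eq with h | h
    · exact neg_pos.2 h
    exfalso
    have hmem : ∀ N : ℕ, x + (N : ℝ) • (Pi.single i 1 : Fin n → ℝ) ∈ F := by
      intro N
      rw [hl, ← hpoint]
      refine ⟨add_toPoint_mem_newtonPolyhedron hx'.1 _, fun y hy => ?_⟩
      rw [hpoint, map_add, map_smul, h]
      simpa using hx'.2 y hy
    obtain ⟨C, hC⟩ := ((hF.2.image (continuous_apply i)).isBounded).bddAbove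
    obtain ⟨N, hN⟩ := exists_nat_gt (C - x i)
    have := hC ⟨_, hmem N, rfl⟩
    simp at this
    linarith
  · rw [hdot]
    exact neg_le_neg (hx'.2 _ (toPoint_mem_newtonPolyhedron ha))
  · ext y
    simp only [supportFace, Set.mem_ofPred_eq, hdot, neg_inj]
    rw [hl]
    refine and_congr_right fun hy =>
      ⟨fun h => le_antisymm (hx'.2 y hy) (h x hx'.1), fun h z hz => ?_⟩
    rw [h]
    exact hx'.2 z hz

theorem isCompactFace_empty : IsCompactFace I ∅ :=
  ⟨fun h => absurd h Set.not_nonempty_empty, isCompact_empty⟩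

theorem exists_supports_one (h : (exponents I).Nonempty) :
    ∃ c, ∃ a ∈ exponents I, Supports I 1 c ∧ (1 : Fin n → ℝ) ⬝ᵥ toPoint a = c := by
  obtain ⟨a, ha, hmin⟩ := WellFounded.has_min (measure fun a : Fin n →₀ ℕ => ∑ i, a i).wf
    (exponents I) h
  have hsum : ∀ b : Fin n →₀ ℕ, (1 : Fin n → ℝ) ⬝ᵥ toPoint b = ((∑ i, b i : ℕ) : ℝ) := by
    intro b
    simp [dotProduct, toPoint]
  refine ⟨_, a, ha, ⟨fun _ => one_pos, fun b hb => ?_⟩, rfl⟩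
  rw [hsum, hsum]
  exact_mod_cast not_lt.1 (hmin b hb)

theorem exists_supports_of_maximal {F : Set (Fin n → ℝ)} (hF : Maximal (IsCompactFace I) F) :
    ∃ w c, Supports I w c ∧ F = supportFace I w c := by
  rcases F.eq_empty_or_nonempty with rfl | hne
  · rcases (exponents I).eq_empty_or_nonempty with hI | hI
    -- For `I = 0` the polyhedron is empty, and any positive weight cuts out the empty face.
    · refine ⟨1, 0, ⟨fun _ => one_pos, by simp [hI]⟩, ?_⟩
      simp [supportFace, newtonPolyhedron, hI]
    · obtain ⟨c, a, ha, h, hac⟩ := exists_supports_one hI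
      exact absurd (hF.2 (h.isCompactFace ha hac) (Set.empty_subset _)
        ⟨toPoint_mem_newtonPolyhedron ha, hac⟩) (Set.notMem_empty _)
  · exact hF.1.exists_supports hne

theorem IsCompactFace.eq_convexHull {F : Set (Fin n → ℝ)} (hF : IsCompactFace I F) :
    F = convexHull ℝ (toPoint '' {a ∈ minGenExponents I | toPoint a ∈ F}) := by
  rcases F.eq_empty_or_nonempty with rfl | hne
  · simp
  · obtain ⟨w, c, h, rfl⟩ := hF.exists_supports hne
    conv_lhs => rw [h.supportFace_eq_and_le.2]
    congr 2
    ext a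
    exact ⟨fun ha => ⟨h.mem_minGenExponents ha.1 ha.2, toPoint_mem_newtonPolyhedron ha.1, ha.2⟩,
      fun ha => ⟨ha.1.1, ha.2.2⟩⟩

theorem finite_setOf_isCompactFace (I : Ideal (MvPolynomial (Fin n) K)) :
    {F | IsCompactFace I F}.Finite := by
  refine ((finite_minGenExponents I).finite_subsets.image
    fun S => convexHull ℝ (toPoint '' S)).subset fun F hF => ?_
  exact ⟨_, fun a ha => ha.1, hF.eq_convexHull.symm⟩

theorem exists_maximal_ge {F : Set (Fin n → ℝ)} (hF : IsCompactFace I F) :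
    ∃ F', F ⊆ F' ∧ Maximal (IsCompactFace I) F' :=
  (finite_setOf_isCompactFace I).exists_le_maximal hF

end Faces

/-! ### Minimal primes of the fiber ring -/

section MinimalPrimes

variable {K : Type*} [Field K] {n : ℕ} {I : Ideal (MvPolynomial (Fin n) K)}

theorem coe_prod_monomialT_pow {ι : Type*} (T : Finset ι) (g : ι → exponents I) (N : ι → ℕ) :
    ((∏ i ∈ T, monomialT I (g i) ^ N i : reesAlgebra I) : Polynomial (MvPolynomial (Fin n) K)) =
      Polynomial.monomial (∑ i ∈ T, N i)
        (monomial (∑ i ∈ T, N i • (g i : Fin n →₀ ℕ)) (1 : K)) := by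
  classical
  induction T using Finset.induction_on with
  | empty => rfl
  | insert j T hj ih =>
    rw [Finset.prod_insert hj, Finset.sum_insert hj, Finset.sum_insert hj, MulMemClass.coe_mul, ih,
      SubmonoidClass.coe_pow]
    simp [monomialT, Polynomial.monomial_pow, monomial_pow, Polynomial.monomial_mul_monomial,
      monomial_mul]

/-- The exponents `a` for which `x ^ a t` avoids a given prime of the fiber ring lie on a common
compact face. -/
theorem exists_compactFace_of_isPrime {q : Ideal (reesAlgebra I)} [q.IsPrime]
    (hq : fiberIdeal I ≤ q) :
    ∃ F, IsCompactFace I F ∧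
      ∀ a : exponents I, monomialT I a ∉ q → toPoint (a : Fin n →₀ ℕ) ∈ F := by
  by_cases hS : ∃ a₀ : exponents I, monomialT I a₀ ∉ q
  swap
  · push Not at hS
    exact ⟨∅, isCompactFace_empty, fun a ha => absurd (hS a) ha⟩
  obtain ⟨a₀, ha₀⟩ := hS
  -- If `x ^ b` properly divides `x ^ a` in `I`, then `x ^ a t` is a multiple of `x ^ b t` by an
  -- element of `𝔪`, hence lies in `q`.
  have hmin : ∀ a : exponents I, monomialT I a ∉ q → (a : Fin n →₀ ℕ) ∈ minGenExponents I := by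
    refine fun a ha => ⟨a.2, fun b hb hba => ?_⟩
    obtain ⟨d, hd⟩ := exists_add_of_le hba
    by_cases hd0 : d = 0
    · simp [hd, hd0]
    · refine absurd ?_ ha
      have : monomialT I a =
          algebraMap (MvPolynomial (Fin n) K) (reesAlgebra I) (monomial d 1) * monomialT I ⟨b, hb⟩ := by
        refine Subtype.ext ?_
        rw [MulMemClass.coe_mul, coe_algebraMap_monomial]
        simp [monomialT, hd, monomial_mul, add_comm]
      rw [this]
      exact q.mul_mem_right _ (hq (algebraMap_monomial_mem_fiberIdeal hd0 1))
  have := (finite_minGenExponents I).to_subtype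
  have := Fintype.ofFinite (minGenExponents I)
  classical
  -- Indexing by pairs (generator, generator outside `q`) makes both products below have the same
  -- number of factors, hence the same degree in `t`.
  let ι := minGenExponents I × {s : minGenExponents I // monomialT I ⟨s, s.2.1⟩ ∉ q}
  let g : ι → exponents I := fun i => ⟨i.1, i.1.2.1⟩
  let s : ι → exponents I := fun i => ⟨i.2.1, i.2.1.2.1⟩
  obtain ⟨w, hw, hle⟩ := exists_weight (fun i => (g i : Fin n →₀ ℕ)) (fun i => (s i : Fin n →₀ ℕ))
    fun N m hNm => by
      by_contra hm
      have hprod : ∏ i, monomialT I (s i) ^ N i =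
          algebraMap (MvPolynomial (Fin n) K) (reesAlgebra I) (monomial m 1) * ∏ i, monomialT I (g i) ^ N i := by
        refine Subtype.ext ?_
        rw [MulMemClass.coe_mul, coe_algebraMap_monomial, coe_prod_monomialT_pow,
          coe_prod_monomialT_pow, Polynomial.monomial_mul_monomial, monomial_mul, hNm, add_comm m,
          zero_add, mul_one]
      have hmem : ∏ i, monomialT I (s i) ^ N i ∈ q := by
        rw [hprod]
        exact q.mul_mem_right _ (hq (algebraMap_monomial_mem_fiberIdeal hm 1))
      obtain ⟨i, -, hi⟩ := (Ideal.IsPrime.prod_mem_iff (p := q)).1 hmem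
      exact i.2.2 (Ideal.IsPrime.mem_of_pow_mem ‹_› _ hi)
  have hle' : ∀ b (hb : b ∈ exponents I) (a : exponents I), monomialT I a ∉ q →
      w ⬝ᵥ toPoint (a : Fin n →₀ ℕ) ≤ w ⬝ᵥ toPoint b := by
    intro b hb a ha
    -- The weight was chosen against the finitely many minimal generators; positivity extends the
    -- inequality to their multiples.
    obtain ⟨d, hdb, hd⟩ := exists_minimal_le_of_wellFoundedLT (· ∈ exponents I) b hb
    obtain ⟨e, rfl⟩ := exists_add_of_le hdb
    rw [toPoint_add, dotProduct_add]
    have := hle (⟨d, hd⟩, ⟨⟨a, hmin a ha⟩, ha⟩)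
    linarith [dotProduct_toPoint_nonneg hw e]
  have hsupp : Supports I w (w ⬝ᵥ toPoint (a₀ : Fin n →₀ ℕ)) :=
    ⟨hw, fun b hb => hle' b hb a₀ ha₀⟩
  exact ⟨_, hsupp.isCompactFace a₀.2 rfl, fun a ha => ⟨toPoint_mem_newtonPolyhedron a.2,
    le_antisymm (hle' _ a₀.2 a ha) (hle' _ a.2 a₀ ha₀)⟩⟩

/-- The prime determines which `x ^ a t` lie off the face, and each face is the convex hull of the
exponents on it. -/
theorem supportFace_subset_of_facePrime_le {w w' : Fin n → ℝ} {c c' : ℝ} {hI : IsMonomial I}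
    {h : Supports I w c} {h' : Supports I w' c'} (hle : facePrime hI h ≤ facePrime hI h') :
    supportFace I w' c' ⊆ supportFace I w c := by
  rw [h.supportFace_eq_and_le.2, h'.supportFace_eq_and_le.2]
  refine convexHull_mono (Set.image_mono fun a ha => ⟨ha.1, ?_⟩)
  by_contra hne
  exact monomialT_mem_facePrime.1
    (hle (monomialT_mem_facePrime (hI := hI) (h := h) (a := ⟨a, ha.1⟩) |>.2 hne)) ha.2

/-- The minimal primes over `J` are in bijection with any antichain of primes over `J` that is
coinitial among all of them. -/
theorem exists_bijective_minimalPrimes_quotient {R α : Type*} [CommRing R] {J : Ideal R}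
    (Q : α → Ideal R) (hprime : ∀ x, (Q x).IsPrime) (hJ : ∀ x, J ≤ Q x)
    (hanti : ∀ x y, Q x ≤ Q y → x = y)
    (hex : ∀ q : Ideal R, q.IsPrime → J ≤ q → ∃ x, Q x ≤ q) :
    ∃ ρ : α → minimalPrimes (R ⧸ J), Function.Bijective ρ := by
  have hmin : ∀ x, Q x ∈ J.minimalPrimes := fun x => ⟨⟨hprime x, hJ x⟩, fun q hq hqx => by
    obtain ⟨y, hy⟩ := hex q hq.1 hq.2
    obtain rfl := hanti y x (hy.trans hqx)
    exact hy⟩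
  rw [Ideal.minimalPrimes_eq_comap] at hmin
  choose p hp hpQ using hmin
  refine ⟨fun x => ⟨p x, hp x⟩, fun x y hxy => ?_, fun q => ?_⟩
  · have : p x = p y := congrArg Subtype.val hxy
    exact hanti x y (by rw [← hpQ x, ← hpQ y, this])
  · have hq : q.1.comap (Ideal.Quotient.mk J) ∈ J.minimalPrimes := by
      rw [Ideal.minimalPrimes_eq_comap]
      exact ⟨q, q.2, rfl⟩
    obtain ⟨x, hx⟩ := hex _ hq.1.1 hq.1.2
    have := le_antisymm hx (hq.2 ⟨hprime x, hJ x⟩ hx)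
    rw [← hpQ x] at this
    exact ⟨x, Subtype.ext (Ideal.comap_injective_of_surjective _ Ideal.Quotient.mk_surjective this)⟩

/-- For every monomial ideal, the maximal compact faces of the Newton polyhedron are in bijection
with the minimal primes of the fiber ring. -/
theorem exists_bijective_maximalCompactFaces (hI : IsMonomial I) :
    ∃ ρ : maximalCompactFaces I → minimalPrimes (FiberRing I), Function.Bijective ρ := by
  choose w c h hF using fun F : maximalCompactFaces I => exists_supports_of_maximal F.2
  refine exists_bijective_minimalPrimes_quotient (fun F => facePrime hI (h F))
    (fun F => inferInstance) (fun F => fiberIdeal_le_facePrime hI (h F)) (fun F F' hle => ?_)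
    fun q hq hJ => ?_
  · have hsub := supportFace_subset_of_facePrime_le hle
    rw [← hF, ← hF] at hsub
    exact Subtype.ext (Set.Subset.antisymm (F'.2.2 F.2.1 hsub) hsub)
  · obtain ⟨F₀, hF₀, hmem⟩ := exists_compactFace_of_isPrime hJ
    obtain ⟨F, hsub, hmax⟩ := exists_maximal_ge hF₀
    refine ⟨⟨F, hmax⟩, facePrime_le hI _ hJ fun a ha => ?_⟩
    have := hsub (hmem a ha)
    rw [show F = _ from hF ⟨F, hmax⟩] at this
    exact this.2

end MinimalPrimes

end MonIdeal

/-- Every monomial ideal `I` admits an injective map from the maximal compact faces of `conv(I)`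
to the minimal primes of its fiber ring, which is bijective if `I` is extremal. -/
theorem corollary4p4 {K : Type*} [Field K] {n : ℕ} (I : Ideal (MvPolynomial (Fin n) K))
    (hI : MonIdeal.IsMonomial I) :
    ∃ ρ : MonIdeal.maximalCompactFaces I → minimalPrimes (MonIdeal.FiberRing I),
      Function.Injective ρ ∧ (MonIdeal.IsExtremal I → Function.Bijective ρ) := by
  obtain ⟨ρ, hρ⟩ := MonIdeal.exists_bijective_maximalCompactFaces hI
  exact ⟨ρ, hρ.1, fun _ => hρ⟩
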